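/- **Theorem.** Let $p$ be a prime, let $n\ge p$ be an integer, and write $n=qp+r$ with integers $q\ge 0$ and $0\le r<p$. Let $S_n$ act on $R=\mathbb{F}_p[x_1,\dots,x_n]$ by permuting the variables, and let $R^{S_n}=\mathbb{F}_p[e_1,\dots,e_n]$ be the ring of symmetric polynomials, where $e_i$ is the $i$-th elementary symmetric polynomial and $e_0=1$. Let $\mathrm{Tr}^{S_n}\colon R\to R^{S_n}$, $g\mapsto\sum_{\sigma\in S_n}\sigma\cdot g$, be the transfer; it is $R^{S_n}$-linear, so its image $I_n=\operatorname{Im}(\mathrm{Tr}^{S_n})$ is an ideal of $R^{S_n}$. For $0\le k\le p-1$ define $f_k\in R^{S_n}[t]$ by $$f_k=\begin{cases}\displaystyle\sum_{j=0}^{q}e_{jp+k}\,t^{\,q-j} & \text{if } 0\le k\le r,\\[2ex] \displaystyle\sum_{j=0}^{q-1}e_{jp+k}\,t^{\,q-1-j} & \text{if } r<k\le p-1.\end{cases}$$ Then: 1. The polynomials $f_k$ are, up to reindexing, those obtained by splitting $(t+x_1)\cdots(t+x_n)$ by the residue of the exponent of $t$ modulo $p$: for $g_0,\dots,g_{p-1}\in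 R^{S_n}[t]$, the identity $$(t+x_1)(t+x_2)\cdots(t+x_n)=\sum_{k=0}^{p-1}t^k\,g_k(t^p)$$ holds in $R[t]$ if and only if $g_k=f_{(n-k)\bmod p}$ for all $0\le k\le p-1$, where $(n-k)\bmod p\in\{0,\dots,p-1\}$. 2. The image of the transfer is the elimination ideal $$I_n=\langle f_0,f_1,\dots,f_{p-1}\rangle\cap R^{S_n},$$ where $\langle f_0,\dots,f_{p-1}\rangle$ is the ideal of $R^{S_n}[t]$ generated by the $f_k$. -/

import Mathlib

open MvPolynomial in
/-- The transfer (trace) map `Tr : R → R^{S_n}`, `g ↦ ∑ σ ∈ S_n, σ · g`, where `R = 𝕜[x_1, …, x_n]`,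
`σ` acts by `x_i ↦ x_{σ i}`, and `R^{S_n}` is the ring of symmetric polynomials. It is linear over
`R^{S_n}`, so its range is an ideal of `R^{S_n}`. -/
noncomputable def symTransfer (𝕜 : Type*) [CommRing 𝕜] (n : ℕ) :
    MvPolynomial (Fin n) 𝕜 →ₗ[symmetricSubalgebra (Fin n) 𝕜] symmetricSubalgebra (Fin n) 𝕜 where
  toFun g := ⟨∑ σ : Equiv.Perm (Fin n), rename σ g, by
    rw [mem_symmetricSubalgebra]
    intro τ
    rw [map_sum]
    simp only [rename_rename]
    exact Fintype.sum_equiv (Equiv.mulLeft τ) _ _ (fun σ => rfl)⟩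
  map_add' g h := by
    ext1
    simp [Finset.sum_add_distrib]
  map_smul' s g := by
    ext1
    have hs : ∀ σ : Equiv.Perm (Fin n), rename σ (s : MvPolynomial (Fin n) 𝕜) = s :=
      fun σ => s.2 σ
    simp [Algebra.smul_def, hs, Finset.mul_sum]

/-- The elementary symmetric polynomial `e_i` as an element of `R^{S_n}` (so `e_0 = 1`). -/
noncomputable def symE (𝕜 : Type*) [CommRing 𝕜] (n i : ℕ) :
    MvPolynomial.symmetricSubalgebra (Fin n) 𝕜 :=
  ⟨MvPolynomial.esymm (Fin n) 𝕜 i, MvPolynomial.esymm_isSymmetric (Fin n) 𝕜 i⟩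

/-- The polynomial `f_k^{(r)} ∈ R^{S_n}[t]`, for `n = q p + r` and `0 ≤ k < p`:
`e_k t^q + e_{p+k} t^{q-1} + ⋯ + e_{qp+k}` if `k ≤ r`
(for `k = 0` this is `t^q + e_p t^{q-1} + ⋯ + e_{qp}`), and
`e_k t^{q-1} + e_{p+k} t^{q-2} + ⋯ + e_{(q-1)p+k}` if `r < k`. -/
noncomputable def splitPoly (𝕜 : Type*) [CommRing 𝕜] (n p q r k : ℕ) :
    Polynomial (MvPolynomial.symmetricSubalgebra (Fin n) 𝕜) :=
  if k ≤ r then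
    ∑ j ∈ Finset.range (q + 1), Polynomial.C (symE 𝕜 n (j * p + k)) * Polynomial.X ^ (q - j)
  else
    ∑ j ∈ Finset.range q, Polynomial.C (symE 𝕜 n (j * p + k)) * Polynomial.X ^ (q - 1 - j)

/-! Write A for the ring of symmetric polynomials, F = ∏ (T + x_i) and m = n - p. Part 1 is a
comparison of coefficients. For part 2, both ideals equal the kernel on A of the map π
(`equateFirst`) that sets p variables equal to X.

Transfer (`mem_range_symTransfer_iff`): π is invariant under a p-cycle acting freely on S_n by left
multiplication, so π kills transfers in characteristic p. Conversely, if π f = 0, counting orbits of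
the p-cycle shows that f has no monomial with p equal exponents. The remaining monomials have
stabilizers of order prime to p, so their orbit sums are transfers.

Elimination (`mem_comap_span_splitPoly_iff`): T^p - c divides an image of F iff c is a common root
of the f_k. Since π F is divisible by T^p + X^p, evaluation at -X^p gives one inclusion. Conversely,
over A[t]/⟨f_k⟩ the class c of t is a common root, so F becomes (T^p - c) G. This specializes the
generic product (T^p + X)(T^m + y_1 T^(m-1) + ⋯) over 𝔽_p[y][X]. That ring embeds in the target of π
by y_i ↦ e_i, X ↦ X^p, taking the generic product to π F. Hence an element killed by π already
vanishes generically, so also in the quotient. -/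

/-! ### Splitting polynomials by exponent modulo p -/

open Polynomial in
lemma coeff_sum_X_pow_mul_comp {K : Type*} [CommRing K] {p : ℕ} (h : Fin p → K[X]) (a : ℕ)
    (k : Fin p) :
    (∑ j : Fin p, X ^ (j : ℕ) * (h j).comp (X ^ p)).coeff (p * a + k) = (h k).coeff a := by
  have hp : 0 < p := k.pos
  rw [finsetSum_coeff, Finset.sum_eq_single k]
  · rw [← expand_eq_comp_X_pow, coeff_X_pow_mul, mul_comm, coeff_expand_mul hp]
  · intro j _ hj
    rw [← expand_eq_comp_X_pow, coeff_X_pow_mul']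
    split_ifs with hle
    · rw [coeff_expand hp, if_neg]
      intro hd
      refine hj (Fin.ext ?_)
      have h1 : (p * a + k) % p = k := by
        rw [Nat.mul_add_mod, Nat.mod_eq_of_lt k.2]
      have h2 : (p * a + k) % p = j := by
        obtain ⟨c, hc⟩ := hd
        rw [show p * a + (k : ℕ) = p * c + j by omega, Nat.mul_add_mod, Nat.mod_eq_of_lt j.2]
      omega
    · rfl
  · simp

open Polynomial in
lemma eq_sum_X_pow_mul_comp_iff {K : Type*} [CommRing K] {p : ℕ} (hp : 0 < p) (F : K[X])
    (h : Fin p → K[X]) :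
    F = ∑ j : Fin p, X ^ (j : ℕ) * (h j).comp (X ^ p) ↔
      ∀ (k : Fin p) (a : ℕ), (h k).coeff a = F.coeff (p * a + k) := by
  constructor
  · rintro rfl k a
    rw [coeff_sum_X_pow_mul_comp]
  · intro H
    ext d
    have := coeff_sum_X_pow_mul_comp h (d / p) ⟨d % p, Nat.mod_lt _ hp⟩
    rw [H] at this
    simpa only [Nat.div_add_mod] using this.symm

open Polynomial in
/-- `T ^ p - c` divides `∑ k, T ^ k * h_k (T ^ p)` iff `c` is a common root of the `h_k`. -/
lemma X_pow_sub_C_dvd_sum_iff {K : Type*} [CommRing K] {p : ℕ} (hp : 0 < p) (h : Fin p → K[X])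
    (c : K) :
    X ^ p - C c ∣ ∑ j : Fin p, X ^ (j : ℕ) * (h j).comp (X ^ p) ↔ ∀ k, (h k).eval c = 0 := by
  -- Modulo T^p - c each T^p may be replaced by c; what remains has degree below p, so it is the
  -- remainder.
  have key : X ^ p - C c ∣ ∑ j : Fin p, X ^ (j : ℕ) * (h j).comp (X ^ p)
      - ∑ j : Fin p, X ^ (j : ℕ) * C ((h j).eval c) := by
    rw [← Finset.sum_sub_distrib]
    refine Finset.dvd_sum fun j _ => ?_
    rw [← mul_sub]
    refine Dvd.dvd.mul_left ?_ _
    have := sub_dvd_eval_sub (X ^ p) (C c) ((h j).map C)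
    rwa [eval_map, eval_map, ← comp, eval₂_hom] at this
  rw [dvd_iff_dvd_of_dvd_sub key]
  constructor
  · intro hd k
    nontriviality K
    have hlt : (∑ j : Fin p, X ^ (j : ℕ) * C ((h j).eval c)).degree < (X ^ p - C c).degree := by
      rw [degree_X_pow_sub_C hp]
      simpa only [mul_comm (C _)] using degree_sum_fin_lt fun j => (h j).eval c
    have hz : ∑ j : Fin p, X ^ (j : ℕ) * C ((h j).eval c) = 0 := by
      by_contra h0
      exact (monic_X_pow_sub_C c hp.ne').not_dvd_of_degree_lt h0 hlt hd
    have := congrArg (fun P => coeff P (k : ℕ)) hz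
    simp only [finsetSum_coeff, coeff_zero, coeff_X_pow_mul', coeff_C] at this
    rw [Finset.sum_eq_single k] at this
    · simpa using this
    · intro j _ hj
      have hj' : (j : ℕ) ≠ k := fun e => hj (Fin.ext e)
      split_ifs <;> first | rfl | omega
    · simp
  · intro hk
    simp [hk]

/-- Reversing the order of summation puts both cases of the definition into one formula, ready for
comparison with F. -/
lemma coeff_splitPoly (𝕜 : Type*) [CommRing 𝕜] {p n q r : ℕ} (hpn : p ≤ n) (hn : n = q * p + r)
    (hr : r < p) (k : Fin p) (a : ℕ) :
    (splitPoly 𝕜 n p q r ((n - k) % p)).coeff a =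
      if p * a + k ≤ n then symE 𝕜 n (n - (p * a + k)) else 0 := by
  have hk := k.2
  have hp : 0 < p := k.pos
  -- Here q ≥ 1 because r < p ≤ n; thus `q - 1` in the definition is not truncated.
  obtain ⟨q, rfl⟩ : ∃ q', q = q' + 1 := by
    refine ⟨q - 1, ?_⟩
    rcases Nat.eq_zero_or_pos q with rfl | h
    · omega
    · omega
  -- Q and k' are quotient and remainder of n - k by p; for k > r one p is borrowed from q * p.
  have main : ∃ Q k', n - k = Q * p + k' ∧ k' < p ∧
      splitPoly 𝕜 n p (q + 1) r ((n - k) % p) =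
        ∑ j ∈ Finset.range (Q + 1),
          Polynomial.C (symE 𝕜 n (j * p + k')) * Polynomial.X ^ (Q - j) := by
    by_cases hkr : (k : ℕ) ≤ r
    · have h1 : n - k = (q + 1) * p + (r - k) := by omega
      refine ⟨q + 1, r - k, h1, by omega, ?_⟩
      have h2 : (n - k) % p = r - k := by
        rw [h1, Nat.mul_add_mod_self_right, Nat.mod_eq_of_lt (by omega)]
      rw [h2, splitPoly, if_pos (by omega)]
    · have h1 : n - k = q * p + (p + r - k) := by
        rw [hn, add_mul]; omega
      refine ⟨q, p + r - k, h1, by omega, ?_⟩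
      have h2 : (n - k) % p = p + r - k := by
        rw [h1, Nat.mul_add_mod_self_right, Nat.mod_eq_of_lt (by omega)]
      rw [h2, splitPoly, if_neg (by omega)]
      rfl
  obtain ⟨Q, k', h1, hk', h2⟩ := main
  rw [h2, Polynomial.finsetSum_coeff]
  simp_rw [Polynomial.coeff_C_mul_X_pow]
  by_cases ha : a ≤ Q
  · obtain ⟨b, rfl⟩ := Nat.exists_eq_add_of_le ha
    have h3 : n = p * a + k + (b * p + k') := by
      have : (a + b) * p = p * a + b * p := by ring
      omega
    rw [if_pos (by omega), Finset.sum_eq_single b]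
    · rw [if_pos (by omega)]
      congr 1
      omega
    · intro j hj hjb
      rw [Finset.mem_range] at hj
      rw [if_neg (by omega)]
    · intro hb
      exact absurd (Finset.mem_range.2 (by omega)) hb
  · rw [if_neg, Finset.sum_eq_zero]
    · intro j _
      rw [if_neg (by omega)]
    · have : p * (Q + 1) ≤ p * a := Nat.mul_le_mul_left _ (by omega)
      have : p * (Q + 1) = Q * p + p := by ring
      omega

lemma coeff_prod_X_add_C_X (𝕜 : Type*) [CommRing 𝕜] (n d : ℕ) :
    (∏ i : Fin n, (Polynomial.X + Polynomial.C (MvPolynomial.X i : MvPolynomial (Fin n) 𝕜))).coeff d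
      = if d ≤ n then MvPolynomial.esymm (Fin n) 𝕜 (n - d) else 0 := by
  split_ifs with h
  · simpa using MvPolynomial.prod_X_add_C_coeff (σ := Fin n) (R := 𝕜) d (by simpa using h)
  · refine Polynomial.coeff_eq_zero_of_natDegree_lt (lt_of_le_of_lt ?_ (not_le.1 h))
    refine (Polynomial.natDegree_prod_le _ _).trans ?_
    refine (Finset.sum_le_card_nsmul _ _ 1 fun i _ => ?_).trans (by simp)
    exact (Polynomial.natDegree_add_C (a := MvPolynomial.X i)).trans_le Polynomial.natDegree_X_le

lemma prod_X_add_C_X_eq_sum_iff (𝕜 : Type*) [CommRing 𝕜] {p n q r : ℕ} (hp : 0 < p) (hpn : p ≤ n)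
    (hn : n = q * p + r) (hr : r < p)
    (g : Fin p → Polynomial (MvPolynomial.symmetricSubalgebra (Fin n) 𝕜)) :
    ∏ i : Fin n, (Polynomial.X + Polynomial.C (MvPolynomial.X i : MvPolynomial (Fin n) 𝕜)) =
        ∑ k : Fin p, Polynomial.X ^ (k : ℕ) *
          ((g k).map (algebraMap (MvPolynomial.symmetricSubalgebra (Fin n) 𝕜)
            (MvPolynomial (Fin n) 𝕜))).comp (Polynomial.X ^ p) ↔
      ∀ k : Fin p, g k = splitPoly 𝕜 n p q r ((n - k) % p) := by
  rw [eq_sum_X_pow_mul_comp_iff hp]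
  simp_rw [Polynomial.ext_iff]
  refine forall_congr' fun k => forall_congr' fun a => ?_
  rw [coeff_splitPoly 𝕜 hpn hn hr, Polynomial.coeff_map, coeff_prod_X_add_C_X, Subtype.ext_iff]
  split_ifs <;> rfl

lemma setOf_splitPoly_eq_range (𝕜 : Type*) [CommRing 𝕜] {p n : ℕ} (q r : ℕ) (hpn : p ≤ n) :
    {f | ∃ k < p, f = splitPoly 𝕜 n p q r k} =
      Set.range fun k : Fin p => splitPoly 𝕜 n p q r ((n - k) % p) := by
  ext f
  constructor
  · rintro ⟨k, hk, rfl⟩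
    -- The reindexing k ↦ (n - k) mod p is an involution.
    refine ⟨⟨(n - k) % p, Nat.mod_lt _ (by omega)⟩, ?_⟩
    have h1 := Nat.div_add_mod (n - k) p
    have h2 : n - (n - k) % p = p * ((n - k) / p) + k := by omega
    simp only [h2, Nat.mul_add_mod, Nat.mod_eq_of_lt hk]
  · rintro ⟨k, rfl⟩
    exact ⟨_, Nat.mod_lt _ k.pos, rfl⟩

/-! ### Orbit counting modulo p and the p-cycle -/

/-- A function invariant under a self-map `τ` with `τ^[p] = id` has the same sum over the whole
set as over its fixed points, in characteristic `p`. -/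
lemma Finset.sum_eq_sum_fixed_of_iterate {α M : Type*} [DecidableEq α] {p : ℕ} [Fact p.Prime]
    (S : Finset α) (τ : α → α) (hS : ∀ a ∈ S, τ a ∈ S) (hτ : τ^[p] = id) (c : α → M)
    [CommRing M] [DecidableEq M] [CharP M p] (hc : ∀ a ∈ S, c (τ a) = c a) :
    ∑ a ∈ S, c a = ∑ a ∈ S with τ a = a, c a := by
  -- Each level set of c is stable under τ, so its size is congruent to its number of fixed points.
  have key : ∀ v : M, ((S.filter fun a => c a = v).card : M) =
      (((S.filter fun a => τ a = a).filter fun a => c a = v).card : M) := by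
    intro v
    let T := S.filter fun a => c a = v
    let τ' : Function.End T := fun a => ⟨τ a, by
      have := Finset.mem_filter.1 a.2
      exact Finset.mem_filter.2 ⟨hS _ this.1, (hc _ this.1).trans this.2⟩⟩
    have hpow : ∀ k (a : T), (((τ' ^ k : Function.End T) a : T) : α) = τ^[k] a := by
      intro k
      induction k with
      | zero => intro a; rfl
      | succ k ih =>
        intro a
        rw [pow_succ, Function.iterate_succ_apply]
        exact ih (τ' a)
    have h1 : τ' ^ p ^ 1 = 1 := by
      funext a
      apply Subtype.ext
      rw [pow_one, hpow, hτ]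
      rfl
    have h2 := Equiv.Perm.card_fixedPoints_modEq h1
    have h3 := CharP.natCast_eq_natCast' M p h2
    rw [Fintype.card_coe] at h3
    refine h3.trans (congrArg Nat.cast ?_)
    rw [← Fintype.card_coe]
    refine Fintype.card_congr ⟨fun a => ⟨a.1.1, ?_⟩, fun a => ⟨⟨a.1, ?_⟩, ?_⟩, fun _ => rfl,
      fun _ => rfl⟩
    · have h4 := Finset.mem_filter.1 a.1.2
      exact Finset.mem_filter.2
        ⟨Finset.mem_filter.2 ⟨h4.1, congrArg Subtype.val (show τ' a.1 = a.1 from a.2)⟩, h4.2⟩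
    · have h4 := Finset.mem_filter.1 a.2
      exact Finset.mem_filter.2 ⟨(Finset.mem_filter.1 h4.1).1, h4.2⟩
    · exact Subtype.ext (Finset.mem_filter.1 (Finset.mem_filter.1 a.2).1).2
  have expand : ∀ U ⊆ S, ∑ a ∈ U, c a = ∑ v ∈ S.image c, ((U.filter fun a => c a = v).card : M) * v := by
    intro U hU
    rw [← Finset.sum_fiberwise_of_maps_to (t := S.image c) (g := c)
      (fun a ha => Finset.mem_image_of_mem _ (hU ha))]
    refine Finset.sum_congr rfl fun v _ => ?_
    rw [Finset.sum_congr rfl (fun a ha => (Finset.mem_filter.1 ha).2), Finset.sum_const,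
      nsmul_eq_mul]
  rw [expand S subset_rfl, expand _ (Finset.filter_subset _ _)]
  exact Finset.sum_congr rfl fun v _ => by rw [key]

/-- The cyclic rotation of the first `p` of `p + m` points. -/
def rotateFirst (p m : ℕ) [NeZero p] : Equiv.Perm (Fin (p + m)) :=
  finSumFinEquiv.permCongr (Equiv.sumCongr (Equiv.addRight 1) (Equiv.refl _))

@[simp]
lemma rotateFirst_castAdd (p m : ℕ) [NeZero p] (i : Fin p) :
    rotateFirst p m (Fin.castAdd m i) = Fin.castAdd m (i + 1) := by
  simp [rotateFirst, Equiv.permCongr_apply]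

@[simp]
lemma rotateFirst_natAdd (p m : ℕ) [NeZero p] (j : Fin m) :
    rotateFirst p m (Fin.natAdd p j) = Fin.natAdd p j := by
  simp [rotateFirst, Equiv.permCongr_apply]

open scoped Fin.CommRing in
lemma rotateFirst_pow (p m : ℕ) [NeZero p] : rotateFirst p m ^ p = 1 := by
  have h : ∀ (k : ℕ) (i : Fin p), (rotateFirst p m ^ k) (Fin.castAdd m i) =
      Fin.castAdd m (i + (k : Fin p)) := by
    intro k
    induction k with
    | zero => simp
    | succ k ih =>
      intro i
      rw [pow_succ', Equiv.Perm.mul_apply, ih, rotateFirst_castAdd, Nat.cast_succ, add_assoc]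
  ext1 x
  refine Fin.addCases (fun i => ?_) (fun j => ?_) x
  · rw [h]
    simp
  · exact Function.IsFixedPt.perm_pow (rotateFirst_natAdd p m j) p

open scoped Fin.CommRing in
lemma eq_castAdd_zero_of_rotate {α : Type*} {p m : ℕ} [NeZero p] {u : Fin (p + m) → α}
    (hu : ∀ x, u (rotateFirst p m x) = u x) (i : Fin p) :
    u (Fin.castAdd m i) = u (Fin.castAdd m 0) := by
  have h : ∀ k : ℕ, u (Fin.castAdd m (k : Fin p)) = u (Fin.castAdd m 0) := by
    intro k
    induction k with
    | zero => simp
    | succ k ih =>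
      rw [Nat.cast_succ, ← rotateFirst_castAdd, hu, ih]
  simpa using h i

/-! ### Setting p variables equal -/

open MvPolynomial in
/-- The specialization of `𝕜[x_1, …, x_{p+m}]` that sets the first `p` variables equal. -/
noncomputable def equateFirst (𝕜 : Type*) [CommRing 𝕜] (p m : ℕ) :
    MvPolynomial (Fin (p + m)) 𝕜 →ₐ[𝕜] Polynomial (MvPolynomial (Fin m) 𝕜) :=
  aeval (Fin.append (fun _ => Polynomial.X) fun j => Polynomial.C (X j))

open MvPolynomial in
lemma equateFirst_monomial (𝕜 : Type*) [CommRing 𝕜] (p m : ℕ) (u : Fin (p + m) →₀ ℕ) (c : 𝕜) :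
    equateFirst 𝕜 p m (monomial u c) =
      Polynomial.monomial (∑ i, u (Fin.castAdd m i))
        (monomial (Finsupp.equivFunOnFinite.symm fun j => u (Fin.natAdd p j)) c) := by
  rw [equateFirst, aeval_monomial, Finsupp.prod_fintype _ _ (fun _ => pow_zero _),
    Fin.prod_univ_add]
  simp only [Fin.append_left, Fin.append_right, Finset.prod_pow_eq_pow_sum]
  rw [← Polynomial.C_mul_X_pow_eq_monomial, monomial_eq,
    Finsupp.prod_fintype _ _ (fun _ => pow_zero _), Polynomial.C_mul, map_prod]
  simp only [Finsupp.equivFunOnFinite_symm_apply_apply, map_pow]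
  rw [IsScalarTower.algebraMap_apply 𝕜 (MvPolynomial (Fin m) 𝕜), algebraMap_eq,
    Polynomial.algebraMap_eq]
  ring

open MvPolynomial in
lemma coeff_coeff_equateFirst {𝕜 : Type*} [CommRing 𝕜] {p m : ℕ} (f : MvPolynomial (Fin (p + m)) 𝕜)
    (a : ℕ) (d : Fin m →₀ ℕ) :
    ((equateFirst 𝕜 p m f).coeff a).coeff d =
      ∑ u ∈ f.support with (∑ i, u (Fin.castAdd m i) = a ∧ ∀ j, u (Fin.natAdd p j) = d j),
        f.coeff u := by
  conv_lhs => rw [f.as_sum, map_sum, Polynomial.finsetSum_coeff, coeff_sum]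
  rw [Finset.sum_filter]
  refine Finset.sum_congr rfl fun u _ => ?_
  rw [equateFirst_monomial, Polynomial.coeff_monomial]
  by_cases h1 : ∑ i, u (Fin.castAdd m i) = a
  · by_cases h2 : ∀ j, u (Fin.natAdd p j) = d j
    · rw [if_pos h1, if_pos ⟨h1, h2⟩, coeff_monomial, if_pos]
      ext j
      simp [h2]
    · rw [if_pos h1, if_neg (fun h => h2 h.2), coeff_monomial, if_neg]
      rintro rfl
      exact h2 fun j => rfl
  · rw [if_neg h1, if_neg (fun h => h1 h.1), coeff_zero]

open MvPolynomial in
lemma equateFirst_rename_rotateFirst {𝕜 : Type*} [CommRing 𝕜] {p m : ℕ} [NeZero p]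
    (f : MvPolynomial (Fin (p + m)) 𝕜) :
    equateFirst 𝕜 p m (rename (rotateFirst p m) f) = equateFirst 𝕜 p m f := by
  rw [equateFirst, aeval_rename]
  congr 2
  funext x
  refine Fin.addCases (fun i => ?_) (fun j => ?_) x <;> simp

open MvPolynomial in
lemma coeff_mapDomain_of_isSymmetric {𝕜 σ : Type*} [CommRing 𝕜] {f : MvPolynomial σ 𝕜}
    (hf : f.IsSymmetric) (τ : Equiv.Perm σ) (u : σ →₀ ℕ) :
    f.coeff (u.mapDomain τ) = f.coeff u := by
  conv_lhs => rw [← hf τ]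
  exact coeff_rename_mapDomain _ τ.injective _ _

open MvPolynomial in
/-- If a symmetric polynomial vanishes when `p` variables become equal, then it contains no
monomial in which these variables have the same exponent. -/
lemma coeff_eq_zero_of_equateFirst_eq_zero {p m : ℕ} [Fact p.Prime]
    {f : MvPolynomial (Fin (p + m)) (ZMod p)} (hf : f.IsSymmetric)
    (h0 : equateFirst (ZMod p) p m f = 0) (u : Fin (p + m) →₀ ℕ) (b : ℕ)
    (hu : ∀ i, u (Fin.castAdd m i) = b) : f.coeff u = 0 := by
  have hp : 0 < p := (Fact.out : p.Prime).pos
  have : NeZero p := ⟨hp.ne'⟩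
  have h1 := coeff_coeff_equateFirst f (p * b)
    (Finsupp.equivFunOnFinite.symm fun j => u (Fin.natAdd p j))
  simp only [h0, Polynomial.coeff_zero, coeff_zero, Finsupp.equivFunOnFinite_symm_apply_apply] at h1
  have hap : ∀ (v : Fin (p + m) →₀ ℕ) (x), v.mapDomain (rotateFirst p m) (rotateFirst p m x) = v x :=
    fun v x => Finsupp.mapDomain_apply (rotateFirst p m).injective _ _
  rw [Finset.sum_eq_sum_fixed_of_iterate (p := p) _ (Finsupp.mapDomain (rotateFirst p m))
    ?_ ?_ (fun v => f.coeff v) fun v _ => coeff_mapDomain_of_isSymmetric hf _ v] at h1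
  · rw [Finset.sum_subset (s₂ := {u}), Finset.sum_singleton] at h1
    · exact h1.symm
    · intro v hv
      obtain ⟨hv1, hv2⟩ := Finset.mem_filter.1 hv
      obtain ⟨-, hv3, hv4⟩ := Finset.mem_filter.1 hv1
      -- A rotation-fixed exponent is constant on the first p places with sum p * b, hence equals b
      -- there: only u survives.
      have hv5 := eq_castAdd_zero_of_rotate (u := v) fun x => by
        conv_lhs => rw [← hv2, hap]
      simp only [hv5, Finset.sum_const, Finset.card_univ, Fintype.card_fin, smul_eq_mul] at hv3
      have hv6 := Nat.eq_of_mul_eq_mul_left hp hv3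
      rw [Finset.mem_singleton]
      ext x
      refine Fin.addCases (fun i => ?_) (fun j => ?_) x
      · rw [hv5, hv6, hu]
      · rw [hv4]
    · intro v hv hv'
      rw [Finset.mem_singleton] at hv
      subst hv
      by_contra hne
      refine hv' (Finset.mem_filter.2 ⟨Finset.mem_filter.2 ⟨mem_support_iff.2 hne, ?_, fun _ => rfl⟩,
        ?_⟩)
      · simp [hu]
      · ext x
        obtain ⟨x, rfl⟩ := (rotateFirst p m).surjective x
        rw [hap]
        refine Fin.addCases (fun i => ?_) (fun j => ?_) x <;> simp [hu]
  · intro v hv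
    obtain ⟨hv1, hv2, hv3⟩ := Finset.mem_filter.1 hv
    refine Finset.mem_filter.2 ⟨?_, ?_, fun j => ?_⟩
    · rw [mem_support_iff, coeff_mapDomain_of_isSymmetric hf]
      exact mem_support_iff.1 hv1
    · rw [← hv2, ← Equiv.sum_comp (Equiv.addRight (1 : Fin p))]
      refine Finset.sum_congr rfl fun i _ => ?_
      rw [Equiv.coe_addRight, ← rotateFirst_castAdd, hap]
    · rw [← hv3 j]
      conv_lhs => rw [← rotateFirst_natAdd, hap]
  · have hit : ∀ k, (Finsupp.mapDomain (M := ℕ) (rotateFirst p m))^[k] =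
        Finsupp.mapDomain (rotateFirst p m ^ k : Equiv.Perm _) := by
      intro k
      induction k with
      | zero => funext v; simp
      | succ k ih =>
        funext v
        rw [Function.iterate_succ_apply', ih, ← Finsupp.mapDomain_comp, pow_succ',
          Equiv.Perm.coe_mul]
    rw [hit, rotateFirst_pow]
    funext v
    simp

-- Left multiplication by the p-cycle has no fixed point on S_n and preserves the specialized
-- summands, so the sum vanishes modulo p.
open MvPolynomial in
lemma equateFirst_symTransfer {p m : ℕ} [Fact p.Prime] (g : MvPolynomial (Fin (p + m)) (ZMod p)) :
    equateFirst (ZMod p) p m (symTransfer (ZMod p) (p + m) g : MvPolynomial _ _) = 0 := by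
  classical
  have hp : 0 < p := (Fact.out : p.Prime).pos
  have : NeZero p := ⟨hp.ne'⟩
  change equateFirst (ZMod p) p m (∑ σ : Equiv.Perm (Fin (p + m)), rename σ g) = 0
  rw [map_sum, Finset.sum_eq_sum_fixed_of_iterate (p := p) _ (fun σ => rotateFirst p m * σ)
    (fun _ _ => Finset.mem_univ _) ?_ _ ?_]
  · rw [Finset.filter_eq_empty_iff.2, Finset.sum_empty]
    intro σ _ hσ
    have h1 : rotateFirst p m = 1 := mul_eq_right.1 hσ
    have h2 := rotateFirst_castAdd p m 0
    rw [h1, Equiv.Perm.one_apply, (Fin.castAdd_injective p m).eq_iff] at h2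
    have h3 : 1 < p := (Fact.out : p.Prime).one_lt
    have : Fact (1 < p) := ⟨h3⟩
    have := congrArg Fin.val h2
    simp [Nat.mod_eq_of_lt h3] at this
  · funext σ
    rw [mul_left_iterate, rotateFirst_pow]
    simp
  · intro σ _
    rw [← equateFirst_rename_rotateFirst (rename σ g), rename_rename]
    rfl

/-! ### The image of the transfer -/

open MvPolynomial in
/-- A symmetric polynomial over a field is a transfer as soon as it contains no monomial whose
stabilizer has order `0` in the field. -/
lemma mem_range_symTransfer {𝕜 : Type*} [Field 𝕜] {n : ℕ} (f : symmetricSubalgebra (Fin n) 𝕜)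
    (hf : ∀ u : Fin n →₀ ℕ,
      ((Finset.univ.filter fun σ : Equiv.Perm (Fin n) => u.mapDomain σ = u).card : 𝕜) = 0 →
        (f : MvPolynomial (Fin n) 𝕜).coeff u = 0) :
    f ∈ LinearMap.range (symTransfer 𝕜 n) := by
  classical
  have hsymm : (f : MvPolynomial (Fin n) 𝕜).IsSymmetric := f.2
  have hcomp : ∀ (σ τ : Equiv.Perm (Fin n)) (u : Fin n →₀ ℕ),
      (u.mapDomain σ).mapDomain τ = u.mapDomain (τ * σ : Equiv.Perm (Fin n)) :=
    fun σ τ u => by rw [← Finsupp.mapDomain_comp, Equiv.Perm.coe_mul]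
  have hone : ∀ u : Fin n →₀ ℕ, u.mapDomain (1 : Equiv.Perm (Fin n)) = u := fun u => by simp
  let s : Setoid (Fin n →₀ ℕ) :=
    { r := fun u v => ∃ σ : Equiv.Perm (Fin n), u.mapDomain σ = v
      iseqv :=
        { refl := fun u => ⟨1, hone u⟩
          symm := by
            rintro u v ⟨σ, rfl⟩
            exact ⟨σ⁻¹, by rw [hcomp, inv_mul_cancel, hone]⟩
          trans := by
            rintro u v w ⟨σ, rfl⟩ ⟨τ, rfl⟩
            exact ⟨τ * σ, (hcomp _ _ _).symm⟩ } }
  let rep : (Fin n →₀ ℕ) → (Fin n →₀ ℕ) := fun u => (Quotient.mk s u).out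
  have hrep : ∀ u, ∃ σ : Equiv.Perm (Fin n), u.mapDomain σ = rep u := fun u =>
    s.symm (Quotient.mk_out (s := s) u)
  have hrepσ : ∀ (σ : Equiv.Perm (Fin n)) u, rep (u.mapDomain σ) = rep u := fun σ u =>
    congrArg Quotient.out (Quotient.sound (s := s) (s.symm ⟨σ, rfl⟩))
  let N : (Fin n →₀ ℕ) → ℕ := fun u =>
    (Finset.univ.filter fun σ : Equiv.Perm (Fin n) => u.mapDomain σ = u).card
  let F : MvPolynomial (Fin n) 𝕜 := f
  -- One monomial per orbit, divided by the stabilizer order since the transfer repeats each orbit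
  -- element that many times. Where N u = 0 in 𝕜, `hf` makes the coefficient zero anyway.
  let g : MvPolynomial (Fin n) 𝕜 :=
    ∑ u ∈ F.support with rep u = u, monomial u (F.coeff u / N u)
  have hg : ∀ u, g.coeff u = if rep u = u then F.coeff u / N u else 0 := by
    intro u
    simp only [g, coeff_sum, coeff_monomial]
    rw [Finset.sum_ite_eq']
    by_cases h1 : rep u = u
    · by_cases h2 : F.coeff u = 0 <;> simp [h1, h2]
    · simp [h1]
  refine ⟨g, Subtype.ext (MvPolynomial.ext _ _ fun u => ?_)⟩
  change coeff u (∑ σ : Equiv.Perm (Fin n), rename σ g) = F.coeff u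
  obtain ⟨τ, hτ⟩ := hrep u
  have hterm : ∀ σ : Equiv.Perm (Fin n), coeff u (rename σ g) =
      if u.mapDomain (σ⁻¹ : Equiv.Perm (Fin n)) = rep u then F.coeff (rep u) / N (rep u) else 0 := by
    intro σ
    have h1 : u = (u.mapDomain (σ⁻¹ : Equiv.Perm (Fin n))).mapDomain σ := by
      rw [hcomp, mul_inv_cancel, hone]
    conv_lhs => rw [h1, coeff_rename_mapDomain _ σ.injective, hg, hrepσ]
    by_cases h : u.mapDomain (σ⁻¹ : Equiv.Perm (Fin n)) = rep u
    · rw [if_pos h.symm, if_pos h, h]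
    · rw [if_neg (Ne.symm h), if_neg h]
  rw [coeff_sum, Finset.sum_congr rfl fun σ _ => hterm σ, ← Finset.sum_filter, Finset.sum_const,
    nsmul_eq_mul]
  have hcard : (Finset.univ.filter fun σ : Equiv.Perm (Fin n) =>
      u.mapDomain (σ⁻¹ : Equiv.Perm (Fin n)) = rep u).card = N (rep u) := by
    -- σ ↦ σ⁻¹ τ⁻¹ maps this set onto the stabilizer of rep u.
    refine Finset.card_equiv ((Equiv.inv _).trans (Equiv.mulRight τ⁻¹)) fun σ => ?_
    simp only [Finset.mem_filter, Finset.mem_univ, true_and, Equiv.trans_apply, Equiv.inv_apply,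
      Equiv.coe_mulRight]
    rw [← hcomp]
    have : (rep u).mapDomain (τ⁻¹ : Equiv.Perm (Fin n)) = u := by
      rw [← hτ, hcomp, inv_mul_cancel, hone]
    rw [this]
  have hc : F.coeff (rep u) = F.coeff u := by
    rw [← hτ, coeff_mapDomain_of_isSymmetric hsymm]
  rw [hcard, ← hc]
  by_cases h0 : (N (rep u) : 𝕜) = 0
  · rw [h0, zero_mul]
    exact (hf _ h0).symm
  · rw [mul_div_cancel₀ _ h0]

/-- If the stabilizer of `u` has order divisible by `p`, then `u` takes some value `p` times. -/
lemma exists_injective_of_dvd_card_stabilizer {p n : ℕ} (hp : p.Prime) (u : Fin n →₀ ℕ)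
    (h : p ∣ (Finset.univ.filter fun σ : Equiv.Perm (Fin n) => u.mapDomain σ = u).card) :
    ∃ (ι : Fin p → Fin n) (b : ℕ), Function.Injective ι ∧ ∀ i, u (ι i) = b := by
  have h1 : (Finset.univ.filter fun σ : Equiv.Perm (Fin n) => u.mapDomain σ = u).card =
      Fintype.card {σ : Equiv.Perm (Fin n) // u ∘ σ = u} := by
    rw [Fintype.card_subtype]
    congr 1
    ext σ
    simp only [Finset.mem_filter, Finset.mem_univ, true_and]
    constructor
    · intro hσ
      funext x
      conv_lhs => rw [← hσ]
      exact Finsupp.mapDomain_apply σ.injective _ _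
    · intro hσ
      ext x
      obtain ⟨x, rfl⟩ := σ.surjective x
      rw [Finsupp.mapDomain_apply σ.injective]
      exact (congrFun hσ x).symm
  -- The stabilizer order is the product of the factorials of the fibre sizes of u.
  rw [h1, DomMulAct.stabilizer_card', hp.prime.dvd_finsetProd_iff] at h
  obtain ⟨b, -, hb⟩ := h
  rw [hp.dvd_factorial] at hb
  obtain ⟨e⟩ := Function.Embedding.nonempty_of_card_le (α := Fin p) (β := {a // u a = b})
    (by simpa using hb)
  exact ⟨fun i => e i, b, fun i j hij => e.injective (Subtype.ext hij), fun i => (e i).2⟩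

open MvPolynomial in
/-- The image of the transfer consists of the symmetric polynomials that vanish when `p` variables
become equal. -/
lemma mem_range_symTransfer_iff {p m : ℕ} [Fact p.Prime]
    (f : symmetricSubalgebra (Fin (p + m)) (ZMod p)) :
    f ∈ LinearMap.range (symTransfer (ZMod p) (p + m)) ↔
      equateFirst (ZMod p) p m (f : MvPolynomial _ _) = 0 := by
  constructor
  · rintro ⟨g, rfl⟩
    exact equateFirst_symTransfer g
  · intro h
    refine mem_range_symTransfer f fun u hu => ?_
    rw [ZMod.natCast_eq_zero_iff] at hu
    obtain ⟨ι, b, hι, hb⟩ := exists_injective_of_dvd_card_stabilizer Fact.out u hu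
    obtain ⟨σ, hσ⟩ := Equiv.Perm.exists_extending_pair _ _ (Fin.castAdd_injective p m) hι
    have hsymm : (f : MvPolynomial (Fin (p + m)) (ZMod p)).IsSymmetric := f.2
    rw [← coeff_mapDomain_of_isSymmetric hsymm σ⁻¹ u]
    refine coeff_eq_zero_of_equateFirst_eq_zero hsymm h _ b fun i => ?_
    rw [← hb i, ← hσ i]
    conv_lhs => rw [← σ.symm_apply_apply (Fin.castAdd m i)]
    exact Finsupp.mapDomain_apply (σ⁻¹ : Equiv.Perm _).injective _ _

/-! ### The generic factorization -/

lemma Polynomial.X_add_C_pow_char {K : Type*} [CommRing K] (p : ℕ) [Fact p.Prime] [CharP K p]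
    (a : K) : (X + C a) ^ p = X ^ p + C (a ^ p) := by
  rw [C_pow]
  exact add_pow_char (R := Polynomial K) X (C a) p

open MvPolynomial in
lemma map_equateFirst_prod_X_add_C_X (p m : ℕ) [Fact p.Prime] :
    (∏ i : Fin (p + m), (Polynomial.X + Polynomial.C
        (X i : MvPolynomial (Fin (p + m)) (ZMod p)))).map (equateFirst (ZMod p) p m : _ →+* _) =
      (Polynomial.X ^ p + Polynomial.C (Polynomial.X ^ p)) *
        (∏ j : Fin m, (Polynomial.X + Polynomial.C (X j : MvPolynomial (Fin m) (ZMod p)))).map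
          Polynomial.C := by
  rw [Polynomial.map_prod, Polynomial.map_prod, Fin.prod_univ_add, ← Polynomial.X_add_C_pow_char]
  simp [equateFirst]

lemma Polynomial.Monic.eq_X_pow_add_sum_fin {K : Type*} [CommRing K] {G : Polynomial K} {m : ℕ}
    (hG : G.Monic) (hm : G.natDegree = m) :
    G = X ^ m + ∑ i : Fin m, C (G.coeff (m - 1 - i)) * X ^ (m - 1 - (i : ℕ)) := by
  conv_lhs => rw [hG.as_sum, hm]
  rw [Fin.sum_univ_eq_sum_range (fun i => C (G.coeff (m - 1 - i)) * X ^ (m - 1 - i)) m,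
    Finset.sum_range_reflect (fun i => C (G.coeff i) * X ^ i) m]

/-- The polynomial `T ^ m + y_1 T ^ (m - 1) + ⋯ + y_m`. -/
noncomputable def universalMonic (𝕜 : Type*) [CommRing 𝕜] (m : ℕ) :
    Polynomial (MvPolynomial (Fin m) 𝕜) :=
  Polynomial.X ^ m +
    ∑ i : Fin m, Polynomial.C (MvPolynomial.X i) * Polynomial.X ^ (m - 1 - (i : ℕ))

lemma map_universalMonic {𝕜 K : Type*} [CommRing 𝕜] [CommRing K] {m : ℕ}
    (θ : MvPolynomial (Fin m) 𝕜 →+* K) {G : Polynomial K} (hG : G.Monic) (hm : G.natDegree = m)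
    (hθ : ∀ i : Fin m, θ (MvPolynomial.X i) = G.coeff (m - 1 - i)) :
    (universalMonic 𝕜 m).map θ = G := by
  conv_rhs => rw [hG.eq_X_pow_add_sum_fin hm]
  simp [universalMonic, Polynomial.map_sum, hθ]

lemma monic_prod_X_add_C_X (𝕜 : Type*) [CommRing 𝕜] (m : ℕ) :
    (∏ j : Fin m, (Polynomial.X + Polynomial.C (MvPolynomial.X j : MvPolynomial (Fin m) 𝕜))).Monic :=
  Polynomial.monic_prod_of_monic _ _ fun _ _ => Polynomial.monic_X_add_C _

lemma natDegree_prod_X_add_C_X (𝕜 : Type*) [CommRing 𝕜] [Nontrivial 𝕜] (m : ℕ) :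
    (∏ j : Fin m, (Polynomial.X + Polynomial.C
      (MvPolynomial.X j : MvPolynomial (Fin m) 𝕜))).natDegree = m := by
  rw [Polynomial.natDegree_prod_of_monic _ _ fun _ _ => Polynomial.monic_X_add_C _]
  simp

lemma map_esymmAlgHom_universalMonic (𝕜 : Type*) [CommRing 𝕜] [Nontrivial 𝕜] (m : ℕ) :
    (universalMonic 𝕜 m).map
        ((MvPolynomial.symmetricSubalgebra (Fin m) 𝕜).val.comp
          (MvPolynomial.esymmAlgHom (Fin m) 𝕜 m) : _ →+* _) =
      ∏ j : Fin m, (Polynomial.X + Polynomial.C (MvPolynomial.X j : MvPolynomial (Fin m) 𝕜)) := by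
  refine map_universalMonic _ (monic_prod_X_add_C_X 𝕜 m) (natDegree_prod_X_add_C_X 𝕜 m) fun i => ?_
  have hi := i.2
  rw [coeff_prod_X_add_C_X, if_pos (by omega), show m - (m - 1 - i) = i + 1 by omega]
  simp [MvPolynomial.esymmAlgHom]

/-- The polynomial `∏ i, (T + x_i)` with coefficients in the symmetric polynomials. -/
noncomputable def symProd (𝕜 : Type*) [CommRing 𝕜] (n : ℕ) :
    Polynomial (MvPolynomial.symmetricSubalgebra (Fin n) 𝕜) :=
  (universalMonic 𝕜 n).map (MvPolynomial.esymmAlgHom (Fin n) 𝕜 n : _ →+* _)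

lemma map_symProd (𝕜 : Type*) [CommRing 𝕜] [Nontrivial 𝕜] (n : ℕ) :
    (symProd 𝕜 n).map (algebraMap (MvPolynomial.symmetricSubalgebra (Fin n) 𝕜)
      (MvPolynomial (Fin n) 𝕜)) =
      ∏ i : Fin n, (Polynomial.X + Polynomial.C (MvPolynomial.X i : MvPolynomial (Fin n) 𝕜)) := by
  rw [← map_esymmAlgHom_universalMonic, symProd, Polynomial.map_map]
  rfl

lemma monic_symProd (𝕜 : Type*) [CommRing 𝕜] [Nontrivial 𝕜] (n : ℕ) : (symProd 𝕜 n).Monic := by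
  refine Polynomial.monic_of_injective
    (f := algebraMap (MvPolynomial.symmetricSubalgebra (Fin n) 𝕜) (MvPolynomial (Fin n) 𝕜))
    Subtype.val_injective ?_
  rw [map_symProd]
  exact monic_prod_X_add_C_X 𝕜 n

lemma natDegree_symProd (𝕜 : Type*) [CommRing 𝕜] [Nontrivial 𝕜] (n : ℕ) :
    (symProd 𝕜 n).natDegree = n := by
  rw [← Polynomial.natDegree_map_eq_of_injective
    (f := algebraMap (MvPolynomial.symmetricSubalgebra (Fin n) 𝕜) (MvPolynomial (Fin n) 𝕜))
    Subtype.val_injective, map_symProd, natDegree_prod_X_add_C_X]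

lemma coeff_symProd (𝕜 : Type*) [CommRing 𝕜] [Nontrivial 𝕜] (n : ℕ) (i : Fin n) :
    (symProd 𝕜 n).coeff (n - 1 - i) = symE 𝕜 n (i + 1) := by
  apply Subtype.val_injective
  have hi := i.2
  have := congrArg (fun P => Polynomial.coeff P (n - 1 - i)) (map_symProd 𝕜 n)
  simp only [Polynomial.coeff_map] at this
  rw [coeff_prod_X_add_C_X, if_pos (by omega), show n - (n - 1 - i) = i + 1 by omega] at this
  exact this

-- By the fundamental theorem on symmetric polynomials, α is determined by the image of F.
open MvPolynomial in
lemma algHom_eq_aeval_coeff_map_symProd {𝕜 K : Type*} [CommRing 𝕜] [Nontrivial 𝕜] [CommRing K] [Algebra 𝕜 K]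
    {n : ℕ} (α : symmetricSubalgebra (Fin n) 𝕜 →ₐ[𝕜] K) (a : symmetricSubalgebra (Fin n) 𝕜) :
    α a = aeval (fun i : Fin n => ((symProd 𝕜 n).map (α : _ →+* K)).coeff (n - 1 - i))
      ((esymmAlgEquiv (Fin n) 𝕜 (Fintype.card_fin n)).symm a) := by
  obtain ⟨P, rfl⟩ := (esymmAlgEquiv (Fin n) 𝕜 (Fintype.card_fin n)).surjective a
  rw [AlgEquiv.symm_apply_apply]
  change (α.comp (esymmAlgHom (Fin n) 𝕜 n)) P = _
  congr 1
  ext i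
  rw [aeval_X, Polynomial.coeff_map, coeff_symProd, AlgHom.comp_apply, esymmAlgHom, aeval_X]
  rfl

open MvPolynomial in
/-- If `∏ (T + x_i)` becomes divisible by `T ^ p - c` under `α`, then `α` kills every symmetric
polynomial that vanishes when the first `p` variables become equal. -/
lemma apply_eq_zero_of_dvd_map_symProd {p m : ℕ} [Fact p.Prime] {Q : Type*} [CommRing Q]
    [Algebra (ZMod p) Q] (α : symmetricSubalgebra (Fin (p + m)) (ZMod p) →ₐ[ZMod p] Q) (c : Q)
    (hd : Polynomial.X ^ p - Polynomial.C c ∣ (symProd (ZMod p) (p + m)).map (α : _ →+* Q))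
    (a : symmetricSubalgebra (Fin (p + m)) (ZMod p))
    (ha : equateFirst (ZMod p) p m (a : MvPolynomial _ _) = 0) : α a = 0 := by
  nontriviality Q
  have hp : p ≠ 0 := (Fact.out : p.Prime).ne_zero
  obtain ⟨G, hG⟩ := hd
  have hD := Polynomial.monic_X_pow_sub_C c hp
  have hF := (monic_symProd (ZMod p) (p + m)).map (α : _ →+* Q)
  have hGm : G.Monic := hD.of_mul_monic_left (hG ▸ hF)
  have hGd : G.natDegree = m := by
    have h1 := congrArg Polynomial.natDegree hG
    rw [hD.natDegree_mul hGm, Polynomial.natDegree_X_pow_sub_C,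
      (monic_symProd (ZMod p) (p + m)).natDegree_map, natDegree_symProd] at h1
    omega
  let B := Polynomial (MvPolynomial (Fin m) (ZMod p))
  let FB : Polynomial B := (Polynomial.X ^ p + Polynomial.C Polynomial.X) *
    (universalMonic (ZMod p) m).map Polynomial.C
  -- The generic value of a: the e_i in its expression are replaced by the coefficients of FB.
  let b : B := aeval (fun i : Fin (p + m) => FB.coeff (p + m - 1 - i))
    ((esymmAlgEquiv (Fin (p + m)) (ZMod p) (Fintype.card_fin _)).symm a)
  let ε : MvPolynomial (Fin m) (ZMod p) →ₐ[ZMod p] MvPolynomial (Fin m) (ZMod p) :=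
    (symmetricSubalgebra (Fin m) (ZMod p)).val.comp (esymmAlgHom (Fin m) (ZMod p) m)
  have hε : Function.Injective ε := Subtype.val_injective.comp
    (esymmAlgHom_injective (σ := Fin m) (R := ZMod p) (Fintype.card_fin m).ge)
  let toK : B →ₐ[ZMod p] B :=
    ((Polynomial.expand (MvPolynomial (Fin m) (ZMod p)) p).restrictScalars (ZMod p)).comp
      (Polynomial.mapAlgHom ε)
  have hmapε : Function.Injective (Polynomial.mapAlgHom ε) :=
    Polynomial.map_injective ε.toRingHom hε
  have htoK : Function.Injective toK :=
    (Polynomial.expand_injective hp.bot_lt).comp hmapε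
  let θ : MvPolynomial (Fin m) (ZMod p) →ₐ[ZMod p] Q := aeval fun i : Fin m => G.coeff (m - 1 - i)
  -- X goes to -c, turning T^p + X into T^p - c.
  let toQ : B →ₐ[ZMod p] Q :=  Polynomial.eval₂AlgHom θ (-c) fun _ => Commute.all _ _
  have hFQ : FB.map (toQ : B →+* Q) = (symProd (ZMod p) (p + m)).map (α : _ →+* Q) := by
    have h1 : (universalMonic (ZMod p) m).map (θ : _ →+* Q) = G :=
      map_universalMonic _ hGm hGd fun i => by simp [θ]
    have h2 : (toQ : B →+* Q).comp Polynomial.C = (θ : _ →+* Q) :=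
      RingHom.ext fun x => Polynomial.eval₂_C _ _
    have h3 : toQ Polynomial.X = -c := Polynomial.eval₂_X _ _
    rw [hG, Polynomial.map_mul, Polynomial.map_map, h2, h1]
    simp [h3, sub_eq_add_neg]
  have hFK : FB.map (toK : B →+* B) = (symProd (ZMod p) (p + m)).map
      ((equateFirst (ZMod p) p m).comp (symmetricSubalgebra (Fin (p + m)) (ZMod p)).val :
        _ →+* B) := by
    have h1 := map_equateFirst_prod_X_add_C_X p m
    rw [← map_symProd, Polynomial.map_map, ← map_esymmAlgHom_universalMonic] at h1
    have h2 : (toK : B →+* B).comp Polynomial.C = Polynomial.C.comp (ε : _ →+* _) := by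
      refine RingHom.ext fun x => ?_
      change Polynomial.expand _ p (Polynomial.map ε.toRingHom (Polynomial.C x)) = _
      rw [Polynomial.map_C, Polynomial.expand_C]
      rfl
    have h3 : toK Polynomial.X = Polynomial.X ^ p := by
      change Polynomial.expand _ p (Polynomial.map ε.toRingHom Polynomial.X) = _
      rw [Polynomial.map_X, Polynomial.expand_X]
    refine Eq.trans ?_ h1.symm
    rw [Polynomial.map_mul, Polynomial.map_map, Polynomial.map_map, h2]
    congr 1
    simp only [Polynomial.map_add, Polynomial.map_pow, Polynomial.map_X, Polynomial.map_C,
      RingHom.coe_coe, h3]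
  have hbK : toK b = 0 := by
    have h1 := algHom_eq_aeval_coeff_map_symProd
      ((equateFirst (ZMod p) p m).comp (symmetricSubalgebra (Fin (p + m)) (ZMod p)).val) a
    have h2 : toK b = _ := (comp_aeval_apply _ toK _)
    rw [h2, ← ha]
    refine Eq.trans ?_ h1.symm
    rw [← hFK]
    simp only [Polynomial.coeff_map]
    rfl
  have hb : b = 0 := htoK (hbK.trans (map_zero toK).symm)
  rw [algHom_eq_aeval_coeff_map_symProd α a, ← hFQ, ← map_zero toQ, ← hb]
  simp only [Polynomial.coeff_map]
  exact (comp_aeval_apply _ toQ _).symm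

-- The elimination ideal

universe u in
/-- The quotient `A[t] / ⟨g_k⟩`, with the class of `t` as common root of the `g_k`. -/
lemma exists_algHom_eval₂_eq_zero {𝕜 ι : Type*} {A : Type u} [CommRing 𝕜] [CommRing A]
    [Algebra 𝕜 A] (g : ι → Polynomial A) :
    ∃ (Q : Type u) (_ : CommRing Q) (_ : Algebra 𝕜 Q) (α : A →ₐ[𝕜] Q) (c : Q),
      (∀ k, (g k).eval₂ (α : A →+* Q) c = 0) ∧
        ∀ a, α a = 0 → Polynomial.C a ∈ Ideal.span (Set.range g) := by
  let I := Ideal.span (Set.range g)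
  let α : A →ₐ[𝕜] (Polynomial A ⧸ I) := (Ideal.Quotient.mkₐ 𝕜 I).comp Polynomial.CAlgHom
  refine ⟨Polynomial A ⧸ I, inferInstance, inferInstance, α, Ideal.Quotient.mk I Polynomial.X,
    fun k => ?_, fun a ha => Ideal.Quotient.eq_zero_iff_mem.1 ha⟩
  have h1 : (g k).eval₂ (α : A →+* _) (Ideal.Quotient.mk I Polynomial.X) =
      Ideal.Quotient.mk I (g k) := by
    conv_rhs => rw [← Polynomial.eval₂_C_X (p := g k), Polynomial.hom_eval₂]
    rfl
  rw [h1, Ideal.Quotient.eq_zero_iff_mem]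
  exact Ideal.subset_span ⟨k, rfl⟩

open MvPolynomial in
lemma mem_comap_span_splitPoly_iff {p m q r : ℕ} [Fact p.Prime] (hn : p + m = q * p + r)
    (hr : r < p) (a : symmetricSubalgebra (Fin (p + m)) (ZMod p)) :
    a ∈ (Ideal.span {f | ∃ k < p, f = splitPoly (ZMod p) (p + m) p q r k}).comap
        (Polynomial.C : symmetricSubalgebra (Fin (p + m)) (ZMod p) →+* _) ↔
      equateFirst (ZMod p) p m (a : MvPolynomial _ _) = 0 := by
  have hp : 0 < p := (Fact.out : p.Prime).pos
  have hpn : p ≤ p + m := Nat.le_add_right p m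
  rw [setOf_splitPoly_eq_range _ _ _ hpn, Ideal.mem_comap]
  set g : Fin p → Polynomial (symmetricSubalgebra (Fin (p + m)) (ZMod p)) :=
    fun k => splitPoly (ZMod p) (p + m) p q r ((p + m - k) % p)
  have hsplit : symProd (ZMod p) (p + m) =
      ∑ k : Fin p, Polynomial.X ^ (k : ℕ) * (g k).comp (Polynomial.X ^ p) := by
    apply Polynomial.map_injective (algebraMap (symmetricSubalgebra (Fin (p + m)) (ZMod p))
      (MvPolynomial (Fin (p + m)) (ZMod p))) Subtype.val_injective
    rw [map_symProd, (prod_X_add_C_X_eq_sum_iff (ZMod p) hp hpn hn hr g).2 fun k => rfl]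
    simp [Polynomial.map_sum, Polynomial.map_comp]
  have hmap : ∀ {K : Type} [CommRing K] (α : symmetricSubalgebra (Fin (p + m)) (ZMod p) →+* K)
      (c : K), Polynomial.X ^ p - Polynomial.C c ∣ (symProd (ZMod p) (p + m)).map α ↔
        ∀ k, (g k).eval₂ α c = 0 := by
    intro K _ α c
    simp_rw [Polynomial.eval₂_eq_eval_map]
    rw [← X_pow_sub_C_dvd_sum_iff hp, hsplit]
    simp [Polynomial.map_sum, Polynomial.map_comp]
  constructor
  · intro ha
    let ρ : symmetricSubalgebra (Fin (p + m)) (ZMod p) →+*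
        Polynomial (MvPolynomial (Fin m) (ZMod p)) :=
      (equateFirst (ZMod p) p m : MvPolynomial (Fin (p + m)) (ZMod p) →+* _).comp (algebraMap _ _)
    -- The root comes from T^p + X^p = T^p - (-X^p).
    have hρ : ∀ k, (g k).eval₂ ρ (-Polynomial.X ^ p) = 0 := by
      rw [← hmap, ← Polynomial.map_map, map_symProd, map_equateFirst_prod_X_add_C_X]
      refine Dvd.dvd.mul_right (dvd_of_eq ?_) _
      simp
    have hle : Ideal.span (Set.range g) ≤
        RingHom.ker (Polynomial.eval₂RingHom ρ (-Polynomial.X ^ p)) := by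
      rw [Ideal.span_le]
      rintro _ ⟨k, rfl⟩
      exact hρ k
    have := hle ha
    rw [RingHom.mem_ker, Polynomial.coe_eval₂RingHom, Polynomial.eval₂_C] at this
    exact this
  · intro ha
    obtain ⟨Q, _, _, α, c, hc, hI⟩ := exists_algHom_eval₂_eq_zero (𝕜 := ZMod p) g
    exact hI a (apply_eq_zero_of_dvd_map_symProd α c ((hmap _ _).2 hc) a ha)

theorem mainTheorem1 (p n q r : ℕ) [Fact p.Prime] (hpn : p ≤ n) (hn : n = q * p + r) (hr : r < p) :
    -- splitting `(t + x_1) ⋯ (t + x_n) = ∑ k, t ^ k * g_k (t ^ p)` gives exactly the `f_k`, reindexed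
    (∀ g : Fin p → Polynomial (MvPolynomial.symmetricSubalgebra (Fin n) (ZMod p)),
      (∏ i : Fin n, (Polynomial.X + Polynomial.C (MvPolynomial.X i : MvPolynomial (Fin n) (ZMod p))) =
        ∑ k : Fin p, Polynomial.X ^ (k : ℕ) *
          ((g k).map (algebraMap (MvPolynomial.symmetricSubalgebra (Fin n) (ZMod p))
            (MvPolynomial (Fin n) (ZMod p)))).comp (Polynomial.X ^ p)) ↔
      ∀ k : Fin p, g k = splitPoly (ZMod p) n p q r ((n - k) % p)) ∧
    -- the image of the transfer is the elimination ideal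
    LinearMap.range (symTransfer (ZMod p) n) =
      (Ideal.span {f | ∃ k < p, f = splitPoly (ZMod p) n p q r k}).comap
        (Polynomial.C : MvPolynomial.symmetricSubalgebra (Fin n) (ZMod p) →+* _) := by
  have hp : 0 < p := (Fact.out : p.Prime).pos
  refine ⟨fun g => prod_X_add_C_X_eq_sum_iff (ZMod p) hp hpn hn hr g, ?_⟩
  obtain ⟨m, rfl⟩ := Nat.exists_eq_add_of_le hpn
  ext a
  rw [mem_range_symTransfer_iff, mem_comap_span_splitPoly_iff hn hr]
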